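/- Let $\mathbb D=\{z\in\mathbb C:|z|<1\}$. A normalized harmonic mapping of $\mathbb D$ is a function $f=h+\overline g$ with $h,g$ analytic in $\mathbb D$ and $h(0)=g(0)=h'(0)-1=0$. It is sense-preserving if $|h'|^2-|g'|^2>0$ in $\mathbb D$, and then its dilatation is $\omega=g'/h'$ (with $h'\ne0$ in $\mathbb D$). For $-1<a<1$, call $f=h+\overline g$ a right half-plane mapping with parameter $a$ if it is normalized, sense-preserving and univalent in $\mathbb D$, $g'(0)=a$, and $\operatorname{Re} f(z)>-(1+a)/2$ for all $z\in\mathbb D$; for such $f$ this says exactly that $h(z)+g(z)=(1+a)z/(1-z)$. Write $\mathcal S(H_0)$ for the class of these mappings with arbitrary $a\in(-1,1)$ and $\mathcal S^0(H_0)$ for those with $a=0$. The convolution of $h(z)=\sum a_nz^n$ and $h_1(z)=\sum A_nz^n$ is $(h_1*h)(z)=\sum a_nA_nz^n$, and the harmonic convolution of $f=h+\overline g$ and $f_1=h_1+\overline{g_1}$ is $f_1*f=h_1*h+\overline{g_1*g}$. A domain is convex in the horizontal direction if its intersection with every horizontal line is connected or empty; a mapping of $\mathbb D$ is convex in the horizontal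 direction if it is univalent in $\mathbb D$ and its range is a domain convex in the horizontal direction. **Theorem.** Let $-1<a<1$ and $\theta\in\mathbb R$. Let $f=h+\overline g\in\mathcal S(H_0)$ (with parameter $a$) satisfy $h(z)+g(z)=(1+a)z/(1-z)$ and have dilatation $\omega(z)=(z+a)/(1+az)$, and let $f_1=h_1+\overline{g_1}\in\mathcal S^0(H_0)$ have dilatation $\omega_1(z)=e^{i\theta}z$. Then $f_1*f$ is a normalized harmonic mapping of $\mathbb D$, $(h_1*h)'\neq0$ in $\mathbb D$ and the dilatation of $f_1*f$ satisfies $\left|\dfrac{(g_1*g)'(z)}{(h_1*h)'(z)}\right|<1$ for all $z\in\mathbb D$; $f_1*f$ is locally univalent in $\mathbb D$; and $f_1*f$ is convex in the horizontal direction. -/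

import Mathlib

open Complex Set Topology

namespace HarmonicConv

/-- The open unit disk. -/
def disk : Set ℂ := Metric.ball (0 : ℂ) 1

/-- The harmonic mapping `f = h + conj g` with analytic part `h` and co-analytic part `g`. -/
noncomputable def harm (h g : ℂ → ℂ) : ℂ → ℂ := fun z => h z + (starRingEnd ℂ) (g z)

/-- `f = h + conj g` is a normalized harmonic mapping of the unit disk: `h` and `g` are analytic in
the disk and `h(0) = g(0) = h'(0) - 1 = 0`. -/
structure IsNormalized (h g : ℂ → ℂ) : Prop where
  analytic_h : DifferentiableOn ℂ h disk
  analytic_g : DifferentiableOn ℂ g disk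
  h_zero : h 0 = 0
  g_zero : g 0 = 0
  deriv_h_zero : deriv h 0 = 1

/-- The Jacobian `|h'|² - |g'|²` of `h + conj g` is positive in the disk. -/
def IsSensePreserving (h g : ℂ → ℂ) : Prop :=
  ∀ z ∈ disk, 0 < ‖deriv h z‖ ^ 2 - ‖deriv g z‖ ^ 2

/-- The class of normalized, sense-preserving, univalent harmonic mappings `h + conj g` of the
unit disk. -/
structure IsSH (h g : ℂ → ℂ) : Prop where
  normalized : IsNormalized h g
  sensePreserving : IsSensePreserving h g
  univalent : InjOn (harm h g) disk

/-- The function `ω` is the dilatation `g' / h'` of `h + conj g` in the disk. -/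
def HasDilatation (h g ω : ℂ → ℂ) : Prop :=
  ∀ z ∈ disk, deriv h z ≠ 0 ∧ deriv g z / deriv h z = ω z

/-- The class of right half-plane mappings with parameter `a`: univalent sense-preserving normalized
harmonic mappings `f = h + conj g` of the disk into the half-plane `Re w > -(1 + a) / 2`, with
`g'(0) = a`. Since `Re f = Re (h + g)`, `(h + g)(0) = 0` and `(h + g)'(0) = 1 + a`, membership
amounts (Schwarz lemma) to `h + g = (1 + a) z / (1 - z)` for such mappings. The image need not be
the whole half-plane. -/
structure IsRightHalfPlane (a : ℝ) (h g : ℂ → ℂ) : Prop where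
  mem_SH : IsSH h g
  deriv_g_zero : deriv g 0 = (a : ℂ)
  re_gt : ∀ z ∈ disk, -(1 + a) / 2 < (harm h g z).re

/-- The `n`-th Taylor coefficient of `F` at the origin. -/
noncomputable def coeff (F : ℂ → ℂ) (n : ℕ) : ℂ := iteratedDeriv n F 0 / (n.factorial : ℂ)

/-- The Hadamard product (convolution) of two functions analytic in the disk: the power series whose
coefficients are the products of the Taylor coefficients. The series converges
in the disk by `summable_hadamard`. -/
noncomputable def hadamard (F G : ℂ → ℂ) : ℂ → ℂ := fun z => ∑' n : ℕ, coeff F n * coeff G n * z ^ n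

theorem hasSum_coeff {F : ℂ → ℂ} (hF : DifferentiableOn ℂ F disk) {z : ℂ} (hz : z ∈ disk) :
    HasSum (fun n => coeff F n * z ^ n) (F z) := by
  have h := Complex.hasSum_taylorSeries_on_ball (f := F) (c := 0) (r := 1)
    (by simpa [disk] using hF) (z := z) (by simpa [disk] using hz)
  refine h.congr_fun ?_ 
  intro n
  simp [coeff, smul_eq_mul]
  ring

theorem summable_hadamard {F G : ℂ → ℂ} (hF : DifferentiableOn ℂ F disk)
    (hG : DifferentiableOn ℂ G disk) {z : ℂ} (hz : z ∈ disk) :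
    Summable (fun n : ℕ => coeff F n * coeff G n * z ^ n) := by
  have hz1 : ‖z‖ < 1 := by simpa [disk] using hz
  set r : ℂ := ((Real.sqrt ‖z‖ : ℝ) : ℂ) with hr
  have hrn : ‖r‖ = Real.sqrt ‖z‖ := by
    rw [hr, Complex.norm_real, Real.norm_of_nonneg (Real.sqrt_nonneg _)]
  have hrd : r ∈ disk := by
    have : Real.sqrt ‖z‖ < 1 := by
      rw [Real.sqrt_lt' one_pos]; simpa using hz1
    simpa [disk, hrn] using this
  have h1 := (hasSum_coeff hF hrd).summable.norm
  have h2 := (hasSum_coeff hG hrd).summable.norm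
  have h3 := h1.mul_of_nonneg h2 (fun _ => norm_nonneg _) (fun _ => norm_nonneg _)
  have h4 := h3.comp_injective (i := fun n : ℕ => (n, n)) (fun a b hab => (Prod.ext_iff.1 hab).1)
  refine Summable.of_norm (h4.congr ?_)
  intro n
  have hs : Real.sqrt ‖z‖ ^ n * Real.sqrt ‖z‖ ^ n = ‖z‖ ^ n := by
    rw [← mul_pow, Real.mul_self_sqrt (norm_nonneg _)]
  simp only [Function.comp, norm_mul, norm_pow, hrn]
  rw [← hs]; ring

/-- `f` is locally univalent in the disk: injective near each point. -/
def IsLocallyUnivalent (f : ℂ → ℂ) : Prop :=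
  ∀ z ∈ disk, ∃ U ∈ 𝓝 z, InjOn f U

/-- A domain is convex in the horizontal direction if it meets every horizontal
line in a connected (or empty) set. -/
def IsCHDDomain (Ω : Set ℂ) : Prop :=
  IsOpen Ω ∧ IsConnected Ω ∧ ∀ t : ℝ, IsPreconnected (Ω ∩ {w : ℂ | w.im = t})

/-- A mapping of the disk is convex in the horizontal direction if it is univalent in the disk and
its range is a domain convex in the horizontal direction. -/
def IsConvexHorizontal (f : ℂ → ℂ) : Prop :=
  InjOn f disk ∧ IsCHDDomain (f '' disk)

end HarmonicConv

/-! Put `p = (1+a)/2`, `q = (1-a)/2`, `e = exp(iθ)`. The data on `f` determine `z h'` and `z g'` as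
`p z/(1-z)^2 ± q z/(1-z^2)`. Convolving with the first term reproduces `z F'` and with the second
the odd part of `F` (`mul_deriv_hadamard`), so `z H' = p z h₁' + (q/2)(h₁(z) - h₁(-z))`, and `z G'`
is the same for `g₁` with `-q`. The change of sign means that `H' - G'` involves the odd part of `h₁
+ g₁ = z/(1-z)`, which is explicit, while `H' + G'` involves that of `D = h₁ - g₁`.

Everything becomes transparent in the coordinate `x = (1+z)/(1-z)` of the right half-plane. There
`D` has derivative `R(x)/2`, where `R = halfPlaneRot e` is a Möbius automorphism of the half-plane,
and `z ↦ -z` becomes `x ↦ 1/x`.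

Sense-preservation: `|G'| < |H'|` means `Re((H'+G') conj(H'-G')) > 0`. With `S` the coordinate of
`z`, and up to the factor `1/(1-z^2)`, `H'-G'` is `p R(S) S + q` and `H'+G'` is `p S + q m`, where
`m` is the mean of `R` over the segment from `1/S` to `S`. It suffices to have positivity with `m`
replaced by `R(x)` for each interior point `x` of the segment; this is `re_mul_conj_pos`, which
rests on the polynomial identity `re_polarized_identity`.

Convexity: by the shear theorem (`isConvexHorizontal_harm`) it is enough to treat the analytic
function `H - G`. In the half-plane its derivative is `(p R(x) + q/x)/2`, of positive real part,
hence univalence. It has an explicit logarithmic primitive, from which the horizontal sections can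
be read off (`injOn_and_isPreconnected_section`). -/

namespace HarmonicConv

/-! ### Taylor coefficients and Hadamard products in the disk. -/

theorem mem_disk {z : ℂ} : z ∈ disk ↔ ‖z‖ < 1 := by simp [disk]

theorem isOpen_disk : IsOpen disk := Metric.isOpen_ball

theorem zero_mem_disk : (0 : ℂ) ∈ disk := by simp [mem_disk]

theorem neg_mem_disk {z : ℂ} (hz : z ∈ disk) : -z ∈ disk := by
  simpa [mem_disk] using hz

theorem hasFPowerSeriesOnBall_of_hasSum {F : ℂ → ℂ} {c : ℕ → ℂ}
    (hF : ∀ z ∈ disk, HasSum (fun n => c n * z ^ n) (F z)) :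
    HasFPowerSeriesOnBall F (FormalMultilinearSeries.ofScalars ℂ c) 0 1 where
  r_le := by
    refine ENNReal.le_of_forall_nnreal_lt fun r hr => ?_
    have hr1 : (r : ℝ) < 1 := by exact_mod_cast hr
    refine FormalMultilinearSeries.le_radius_of_summable_norm _ ?_
    have hz : ((r : ℝ) : ℂ) ∈ disk := by simpa [mem_disk] using hr1
    refine (hF _ hz).summable.norm.congr fun n => ?_
    simp
  r_pos := one_pos
  hasSum := by
    intro y hy
    have hy' : y ∈ disk := by
      rw [mem_disk]
      simpa [Metric.mem_eball, edist_zero_right, enorm_eq_nnnorm, ← NNReal.coe_lt_coe] using hy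
    simpa [FormalMultilinearSeries.ofScalars_apply_eq, mul_comm] using hF y hy'

theorem coeff_eq_of_hasSum {F : ℂ → ℂ} {c : ℕ → ℂ}
    (hF : ∀ z ∈ disk, HasSum (fun n => c n * z ^ n) (F z)) (n : ℕ) : coeff F n = c n := by
  have h := (hasFPowerSeriesOnBall_of_hasSum hF).factorial_smul 1 n
  have hn : ((n.factorial : ℕ) : ℂ) ≠ 0 := by exact_mod_cast n.factorial_ne_zero
  rw [coeff, iteratedDeriv_eq_iteratedFDeriv, div_eq_iff hn]
  rw [show (fun _ : Fin n => (1 : ℂ)) = fun _ => 1 from rfl, ← h]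
  simp [mul_comm]

theorem differentiableOn_of_hasSum {F : ℂ → ℂ} {c : ℕ → ℂ}
    (hF : ∀ z ∈ disk, HasSum (fun n => c n * z ^ n) (F z)) : DifferentiableOn ℂ F disk := by
  have h := (hasFPowerSeriesOnBall_of_hasSum hF).differentiableOn
  have hd : Metric.eball (0 : ℂ) 1 = disk := by
    rw [disk, ← Metric.eball_ofReal]; simp
  rwa [hd] at h

theorem coeff_deriv (F : ℂ → ℂ) (n : ℕ) : coeff (deriv F) n = (n + 1) * coeff F (n + 1) := by
  rw [coeff, coeff, iteratedDeriv_succ', Nat.factorial_succ]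
  have hn : ((n.factorial : ℕ) : ℂ) ≠ 0 := by exact_mod_cast n.factorial_ne_zero
  have hn' : (n : ℂ) + 1 ≠ 0 := by exact_mod_cast n.succ_ne_zero
  push_cast
  field_simp

/-- The Taylor expansion of `z * F' z`. -/
theorem hasSum_mul_deriv {F : ℂ → ℂ} (hF : DifferentiableOn ℂ F disk) {z : ℂ} (hz : z ∈ disk) :
    HasSum (fun n : ℕ => n * coeff F n * z ^ n) (z * deriv F z) := by
  have h := (hasSum_coeff (hF.deriv isOpen_disk) hz).mul_left z
  rw [← hasSum_nat_add_iff' 1]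
  simp only [Finset.range_one, Finset.sum_singleton, Nat.cast_zero, zero_mul, sub_zero]
  refine h.congr_fun fun n => ?_
  rw [coeff_deriv]
  push_cast
  ring

theorem coeff_hadamard {F G : ℂ → ℂ} (hF : DifferentiableOn ℂ F disk)
    (hG : DifferentiableOn ℂ G disk) (n : ℕ) :
    coeff (hadamard F G) n = coeff F n * coeff G n :=
  coeff_eq_of_hasSum (fun _ hz => (summable_hadamard hF hG hz).hasSum) n

theorem differentiableOn_hadamard {F G : ℂ → ℂ} (hF : DifferentiableOn ℂ F disk)
    (hG : DifferentiableOn ℂ G disk) : DifferentiableOn ℂ (hadamard F G) disk :=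
  differentiableOn_of_hasSum fun _ hz => (summable_hadamard hF hG hz).hasSum

theorem coeff_zero (F : ℂ → ℂ) : coeff F 0 = F 0 := by simp [coeff]

theorem coeff_one (F : ℂ → ℂ) : coeff F 1 = deriv F 0 := by simp [coeff]

theorem hadamard_zero {F G : ℂ → ℂ} (hF : DifferentiableOn ℂ F disk)
    (hG : DifferentiableOn ℂ G disk) : hadamard F G 0 = F 0 * G 0 := by
  simpa only [coeff_zero] using coeff_hadamard hF hG 0

theorem deriv_hadamard_zero {F G : ℂ → ℂ} (hF : DifferentiableOn ℂ F disk)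
    (hG : DifferentiableOn ℂ G disk) : deriv (hadamard F G) 0 = deriv F 0 * deriv G 0 := by
  simpa only [coeff_one] using coeff_hadamard hF hG 1

theorem one_sub_ne_zero_of_mem_disk {z : ℂ} (hz : z ∈ disk) : 1 - z ≠ 0 := by
  intro h
  rw [mem_disk, ← sub_eq_zero.1 h] at hz
  simp at hz

theorem one_add_ne_zero_of_mem_disk {z : ℂ} (hz : z ∈ disk) : 1 + z ≠ 0 := by
  simpa using one_sub_ne_zero_of_mem_disk (neg_mem_disk hz)

/-- If `z G' z = p z / (1 - z) ^ 2 + q z / (1 - z ^ 2)`, then convolution with `G` acts on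
derivatives by `z (F * G)' z = p z F' z + q (F z - F (-z)) / 2`. -/
theorem mul_deriv_hadamard {F G : ℂ → ℂ} {p q : ℂ} (hF : DifferentiableOn ℂ F disk)
    (hG : DifferentiableOn ℂ G disk)
    (hG' : ∀ z ∈ disk, z * deriv G z = p * (z / (1 - z) ^ 2) + q * (z / (1 - z ^ 2)))
    {z : ℂ} (hz : z ∈ disk) :
    z * deriv (hadamard F G) z = p * (z * deriv F z) + q / 2 * (F z - F (-z)) := by
  -- The coefficients of `w/(1-w)^2` are `n`; those of `w/(1-w^2)` are `(1-(-1)^n)/2`, the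
  -- projection onto odd powers.
  have hs : ∀ w ∈ disk, HasSum (fun n : ℕ => (p * n + q / 2 * (1 - (-1) ^ n)) * w ^ n)
      (w * deriv G w) := by
    intro w hw
    have hw1 := mem_disk.1 hw
    have h1 := (hasSum_coe_mul_geometric_of_norm_lt_one hw1).mul_left p
    have h2 := (hasSum_geometric_of_norm_lt_one hw1).sub
      (hasSum_geometric_of_norm_lt_one (ξ := -w) (by simpa using hw1))
    have h3 := h1.add (h2.mul_left (q / 2))
    have e1 := one_sub_ne_zero_of_mem_disk hw
    have e2 := one_add_ne_zero_of_mem_disk hw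
    have e3 : 1 - w ^ 2 ≠ 0 := by
      rw [show 1 - w ^ 2 = (1 - w) * (1 + w) by ring]; exact mul_ne_zero e1 e2
    have : w * deriv G w = p * (w / (1 - w) ^ 2) + q / 2 * ((1 - w)⁻¹ - (1 - -w)⁻¹) := by
      rw [hG' w hw, sub_neg_eq_add, show 1 - w ^ 2 = (1 - w) * (1 + w) by ring]
      field_simp
      ring
    rw [this]
    refine h3.congr_fun fun n => ?_
    rw [neg_pow w]
    ring
  have hc : ∀ n : ℕ, (n : ℂ) * coeff G n = p * n + q / 2 * (1 - (-1) ^ n) := fun n => by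
    rw [← coeff_eq_of_hasSum hs, coeff_eq_of_hasSum fun w hw => hasSum_mul_deriv hG hw]
  have h1 := hasSum_mul_deriv (differentiableOn_hadamard hF hG) hz
  have h2 := ((hasSum_mul_deriv hF hz).mul_left p).add
    (((hasSum_coeff hF hz).sub (hasSum_coeff hF (neg_mem_disk hz))).mul_left (q / 2))
  refine h1.unique (h2.congr_fun fun n => ?_)
  rw [coeff_hadamard hF hG, neg_pow z,
    show (n : ℂ) * (coeff F n * coeff G n) = coeff F n * (n * coeff G n) by ring, hc]
  ring

/-! ### Harmonic mappings: openness and the horizontal shear. -/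

theorem harm_re (h g : ℂ → ℂ) (z : ℂ) : (harm h g z).re = (h z + g z).re := by simp [harm]

theorem harm_im (h g : ℂ → ℂ) (z : ℂ) : (harm h g z).im = (h z - g z).im := by
  simp [harm, sub_eq_add_neg]

/-- The inverse of an injective holomorphic function without critical points is holomorphic. -/
theorem hasDerivAt_invFunOn {U : Set ℂ} (hU : IsOpen U) {Φ : ℂ → ℂ}
    (hΦ : DifferentiableOn ℂ Φ U) (hinj : InjOn Φ U) (hne : ∀ z ∈ U, deriv Φ z ≠ 0)
    {z : ℂ} (hz : z ∈ U) :
    HasDerivAt (Function.invFunOn Φ U) (deriv Φ z)⁻¹ (Φ z) := by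
  have hinv : ∀ w ∈ U, Function.invFunOn Φ U (Φ w) = w := fun w hw =>
    hinj.leftInvOn_invFunOn hw
  have hs : HasStrictDerivAt Φ (deriv Φ z) z :=
    (hΦ.analyticAt (hU.mem_nhds hz)).hasStrictDerivAt
  have hmap := hs.map_nhds_eq (hne z hz)
  have hcont : ContinuousAt (Function.invFunOn Φ U) (Φ z) := by
    rw [ContinuousAt, hinv z hz, ← hmap, Filter.tendsto_map'_iff]
    refine Filter.tendsto_id.congr' ?_
    filter_upwards [hU.mem_nhds hz] with w hw
    simp [hinv w hw]
  refine HasDerivAt.of_local_left_inverse (f := Φ) hcont ?_ (hne z hz) ?_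
  · rw [hinv z hz]; exact hs.hasDerivAt
  · rw [← hmap, Filter.eventually_map]
    filter_upwards [hU.mem_nhds hz] with w hw
    rw [hinv w hw]

theorem isOpen_image_of_deriv_ne_zero {U : Set ℂ} (hU : IsOpen U) {Φ : ℂ → ℂ}
    (hΦ : DifferentiableOn ℂ Φ U) (hne : ∀ z ∈ U, deriv Φ z ≠ 0) : IsOpen (Φ '' U) := by
  rw [isOpen_iff_mem_nhds]
  rintro _ ⟨z, hz, rfl⟩
  rw [← ((hΦ.analyticAt (hU.mem_nhds hz)).hasStrictDerivAt).map_nhds_eq (hne z hz)]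
  exact Filter.image_mem_map (hU.mem_nhds hz)

/-- A sense-preserving harmonic mapping is open. -/
theorem isOpen_image_harm {U : Set ℂ} (hU : IsOpen U) {h g : ℂ → ℂ} (hh : DifferentiableOn ℂ h U)
    (hg : DifferentiableOn ℂ g U) (hlt : ∀ z ∈ U, ‖deriv g z‖ < ‖deriv h z‖) :
    IsOpen (harm h g '' U) := by
  rw [isOpen_iff_mem_nhds]
  rintro _ ⟨z, hz, rfl⟩
  have h1 := ((hh.analyticAt (hU.mem_nhds hz)).hasStrictDerivAt).hasStrictFDerivAt.restrictScalars ℝ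
  have h2 := ((hg.analyticAt (hU.mem_nhds hz)).hasStrictDerivAt).hasStrictFDerivAt.restrictScalars ℝ
  have h3 := h1.add ((conjCLE : ℂ →L[ℝ] ℂ).hasStrictFDerivAt.comp z h2)
  have hnhds := h3.map_nhds_eq_of_surj (by
    -- The real differential is an endomorphism of a finite-dimensional space, so a trivial kernel
    -- suffices; a kernel vector `v ≠ 0` would force `|h'| = |g'|`.
    refine LinearMap.range_eq_top.2 ?_
    refine (LinearMap.injective_iff_surjective).1 ?_
    rw [← LinearMap.ker_eq_bot, LinearMap.ker_eq_bot']
    intro v hv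
    by_contra hv0
    have hv1 : v * deriv h z = -(starRingEnd ℂ) (v * deriv g z) := by
      rw [eq_neg_iff_add_eq_zero]
      simpa using hv
    have hv2 := congrArg norm hv1
    rw [norm_neg, RCLike.norm_conj, norm_mul, norm_mul] at hv2
    exact absurd (mul_left_cancel₀ (norm_ne_zero_iff.2 hv0) hv2) (hlt z hz).ne')
  have : harm h g '' U ∈ Filter.map (harm h g) (𝓝 z) := Filter.image_mem_map (hU.mem_nhds hz)
  rwa [show Filter.map (harm h g) (𝓝 z) = 𝓝 (harm h g z) from hnhds] at this

theorem re_add_div_sub_pos {x y : ℂ} (h : ‖y‖ < ‖x‖) : 0 < ((x + y) / (x - y)).re := by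
  have hne : x - y ≠ 0 := by
    intro h0
    rw [sub_eq_zero.1 h0] at h
    exact lt_irrefl _ h
  have h1 : 0 < normSq (x - y) := normSq_pos.2 hne
  have h2 : normSq y < normSq x := by
    rw [normSq_eq_norm_sq, normSq_eq_norm_sq]
    exact pow_lt_pow_left₀ h (norm_nonneg _) two_ne_zero
  rw [div_re, ← add_div]
  refine div_pos ?_ h1
  simp only [normSq_apply, add_re, add_im, sub_re, sub_im] at *
  nlinarith

/-- The shear construction of Clunie and Sheil-Small. -/
theorem isConvexHorizontal_harm {h g : ℂ → ℂ} (hh : DifferentiableOn ℂ h disk)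
    (hg : DifferentiableOn ℂ g disk) (hlt : ∀ z ∈ disk, ‖deriv g z‖ < ‖deriv h z‖)
    (hinj : InjOn (fun z => h z - g z) disk)
    (hsec : ∀ t : ℝ, IsPreconnected ((fun z => h z - g z) '' disk ∩ {w : ℂ | w.im = t})) :
    IsConvexHorizontal (harm h g) := by
  set Φ : ℂ → ℂ := fun z => h z - g z with hΦdef
  have hΦ : DifferentiableOn ℂ Φ disk := hh.sub hg
  have hhd : ∀ z ∈ disk, HasDerivAt h (deriv h z) z := fun z hz =>
    (hh.differentiableAt (isOpen_disk.mem_nhds hz)).hasDerivAt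
  have hgd : ∀ z ∈ disk, HasDerivAt g (deriv g z) z := fun z hz =>
    (hg.differentiableAt (isOpen_disk.mem_nhds hz)).hasDerivAt
  have hΦd : ∀ z ∈ disk, deriv Φ z = deriv h z - deriv g z := fun z hz =>
    ((hhd z hz).sub (hgd z hz)).deriv
  have hne : ∀ z ∈ disk, deriv Φ z ≠ 0 := by
    intro z hz h0
    rw [hΦd z hz, sub_eq_zero] at h0
    exact absurd (congrArg norm h0) (hlt z hz).ne'
  set k := Function.invFunOn Φ disk with hk
  have hinv : ∀ w ∈ disk, k (Φ w) = w := fun w hw => hinj.leftInvOn_invFunOn hw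
  have hkd : ∀ z ∈ disk, HasDerivAt k (deriv Φ z)⁻¹ (Φ z) := fun z hz =>
    hasDerivAt_invFunOn isOpen_disk hΦ hinj hne hz
  have hopen := isOpen_image_of_deriv_ne_zero isOpen_disk hΦ hne
  let ι : ℝ → ℝ → ℂ := fun t x => x + t * I
  have hι : ∀ w : ℂ, ι w.im w.re = w := fun w => re_add_im w
  let J : ℝ → Set ℝ := fun t => {x | ι t x ∈ Φ '' disk}
  -- In the coordinate `w = h - g` the map `harm h g` preserves imaginary parts. On the line `Im w =
  -- t` it therefore acts on real parts only, as `ψ t`, whose derivative is `Re((h'+g')/(h'-g')) >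
  -- 0`.
  let ψ : ℝ → ℝ → ℝ := fun t x => (h (k (ι t x)) + g (k (ι t x))).re
  have hψ : ∀ z ∈ disk, ψ (Φ z).im (Φ z).re = (harm h g z).re := by
    intro z hz
    simp only [ψ]
    rw [hι, hinv z hz, harm_re]
  have hconv : ∀ t, Convex ℝ (J t) := by
    intro t
    have hJ : J t = re '' (Φ '' disk ∩ {w : ℂ | w.im = t}) := by
      ext x
      constructor
      · intro hx
        exact ⟨ι t x, ⟨hx, by simp [ι]⟩, by simp [ι]⟩
      · rintro ⟨w, ⟨hw, rfl⟩, rfl⟩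
        simpa only [J, mem_ofPred_eq, hι] using hw
    rw [hJ]
    exact ((hsec t).image _ continuous_re.continuousOn).ordConnected.convex
  have hder : ∀ t, ∀ x ∈ J t, ∃ d > 0, HasDerivAt (ψ t) d x := by
    rintro t x ⟨z, hz, hzx⟩
    have h1 : HasDerivAt (fun w => h (k w) + g (k w))
        ((deriv h z + deriv g z) / (deriv h z - deriv g z)) (Φ z) := by
      have e := hinv z hz
      have e1 : HasDerivAt (fun w => h (k w)) (deriv h z * (deriv Φ z)⁻¹) (Φ z) :=
        HasDerivAt.comp (Φ z) (by rw [e]; exact hhd z hz) (hkd z hz)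
      have e2 : HasDerivAt (fun w => g (k w)) (deriv g z * (deriv Φ z)⁻¹) (Φ z) :=
        HasDerivAt.comp (Φ z) (by rw [e]; exact hgd z hz) (hkd z hz)
      convert! e1.add e2 using 1
      rw [hΦd z hz]
      ring
    rw [hzx] at h1
    have h2 : HasDerivAt (ι t) 1 x := (ofRealCLM.hasDerivAt (x := x)).add_const _
    have h3 := HasDerivAt.comp x h1 h2
    rw [mul_one] at h3
    refine ⟨_, re_add_div_sub_pos (hlt z hz), ?_⟩
    exact reCLM.hasFDerivAt.comp_hasDerivAt x h3
  have hcont : ∀ t, ContinuousOn (ψ t) (J t) := by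
    intro t x hx
    obtain ⟨d, -, hd⟩ := hder t x hx
    exact hd.continuousAt.continuousWithinAt
  have hmono : ∀ t, StrictMonoOn (ψ t) (J t) := by
    intro t
    refine strictMonoOn_of_deriv_pos (hconv t) (hcont t) fun x hx => ?_
    obtain ⟨d, hd0, hd⟩ := hder t x (interior_subset hx)
    rwa [hd.deriv]
  have hmemJ : ∀ z ∈ disk, (Φ z).re ∈ J (Φ z).im := by
    intro z hz
    simp only [J, mem_ofPred_eq, hι]
    exact mem_image_of_mem _ hz
  refine ⟨?_, isOpen_image_harm isOpen_disk hh hg hlt, ?_, ?_⟩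
  · intro z hz w hw hzw
    have him : (Φ z).im = (Φ w).im := by
      rw [← harm_im, ← harm_im, hzw]
    have h1 := hψ z hz
    have h2 := hψ w hw
    have h3 := hmemJ z hz
    have h4 := hmemJ w hw
    rw [him] at h1 h3
    have hre : (Φ z).re = (Φ w).re := (hmono _).injOn h3 h4 (by rw [h1, h2, hzw])
    exact hinj hz hw (Complex.ext hre him)
  · refine IsConnected.image ?_ _ ?_
    · exact ((convex_ball (0 : ℂ) 1).isConnected ⟨0, zero_mem_disk⟩)
    · exact hh.continuousOn.add (continuous_conj.comp_continuousOn hg.continuousOn)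
  · intro t
    have : harm h g '' disk ∩ {w : ℂ | w.im = t} = (fun x => ι t (ψ t x)) '' J t := by
      ext w
      constructor
      · rintro ⟨⟨z, hz, rfl⟩, rfl⟩
        rw [harm_im]
        refine ⟨(Φ z).re, hmemJ z hz, ?_⟩
        simp only []
        rw [hψ z hz, show (h z - g z).im = (harm h g z).im from (harm_im h g z).symm, hι]
      · rintro ⟨x, ⟨z, hz, hzx⟩, rfl⟩
        have e1 : (Φ z).im = t := by rw [hzx]; simp [ι]
        have e2 : (Φ z).re = x := by rw [hzx]; simp [ι]
        refine ⟨⟨z, hz, ?_⟩, by simp [ι]⟩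
        rw [← e1, ← e2]
        simp only []
        rw [hψ z hz, show (Φ z).im = (harm h g z).im from (harm_im h g z).symm, hι]
    rw [this]
    refine (hconv t).isPreconnected.image _ ?_
    exact (continuous_ofReal.comp_continuousOn (hcont t)).add continuousOn_const

/-! ### Univalence and level curves in the right half-plane. -/

/-- The open right half-plane. -/
def rightHalfPlane : Set ℂ := {x | 0 < x.re}

theorem mem_rightHalfPlane {x : ℂ} : x ∈ rightHalfPlane ↔ 0 < x.re := Iff.rfl

theorem isOpen_rightHalfPlane : IsOpen rightHalfPlane :=
  isOpen_lt continuous_const continuous_re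

theorem convex_rightHalfPlane : Convex ℝ rightHalfPlane :=
  convex_halfSpace_re_gt 0

theorem ne_zero_of_mem_rightHalfPlane {x : ℂ} (hx : x ∈ rightHalfPlane) : x ≠ 0 := by
  rintro rfl
  simp [mem_rightHalfPlane] at hx

theorem add_mul_sub_mem_rightHalfPlane {x y : ℂ} (hx : x ∈ rightHalfPlane)
    (hy : y ∈ rightHalfPlane) {t : ℝ} (ht : t ∈ Icc (0 : ℝ) 1) :
    x + t * (y - x) ∈ rightHalfPlane := by
  rw [mem_rightHalfPlane] at *
  obtain ⟨h0, h1⟩ := ht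
  simp only [add_re, mul_re, ofReal_re, sub_re, ofReal_im, zero_mul, sub_zero]
  rcases h0.eq_or_lt with rfl | h0
  · simpa using hx
  · nlinarith [mul_pos h0 hy, mul_nonneg (sub_nonneg.2 h1) hx.le]

/-- A difference quotient lies in every half-plane containing the derivative along the segment. -/
theorem re_slope_mul_pos {D D' : ℂ → ℂ} (hD : ∀ x ∈ rightHalfPlane, HasDerivAt D (D' x) x)
    {x y c : ℂ} (hx : x ∈ rightHalfPlane) (hy : y ∈ rightHalfPlane) (hxy : x ≠ y)
    (hpos : ∀ t ∈ Ioo (0 : ℝ) 1, 0 < (D' (x + t * (y - x)) * c).re) :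
    0 < ((D y - D x) / (y - x) * c).re := by
  have hne : y - x ≠ 0 := sub_ne_zero.2 hxy.symm
  let φ : ℝ → ℝ := fun t => (D (x + t * (y - x)) / (y - x) * c).re
  have hder : ∀ t ∈ Icc (0 : ℝ) 1, HasDerivAt φ (D' (x + t * (y - x)) * c).re t := by
    intro t ht
    have h1 : HasDerivAt (fun t : ℝ => x + (t : ℂ) * (y - x)) (1 * (y - x)) t :=
      ((ofRealCLM.hasDerivAt (x := t)).mul_const _).const_add _
    have h2 := HasDerivAt.comp t (hD _ (add_mul_sub_mem_rightHalfPlane hx hy ht)) h1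
    have h3 := (h2.div_const (y - x)).mul_const c
    rw [one_mul, mul_div_assoc, div_self hne, mul_one] at h3
    exact reCLM.hasFDerivAt.comp_hasDerivAt t h3
  have hmono : StrictMonoOn φ (Icc 0 1) := by
    refine strictMonoOn_of_deriv_pos (convex_Icc 0 1)
      (fun t ht => (hder t ht).continuousAt.continuousWithinAt) fun t ht => ?_
    rw [interior_Icc] at ht
    rw [(hder t (Ioo_subset_Icc_self ht)).deriv]
    exact hpos t ht
  have h01 := hmono (left_mem_Icc.2 zero_le_one) (right_mem_Icc.2 zero_le_one) zero_lt_one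
  have e : (D y - D x) / (y - x) * c = D y / (y - x) * c - D x / (y - x) * c := by ring
  rw [e, sub_re, sub_pos]
  simpa [φ] using h01

/-- The Noshiro-Warschawski criterion in the half-plane. -/
theorem injOn_of_re_deriv_pos {Ψ Ψ' : ℂ → ℂ} (hΨ : ∀ x ∈ rightHalfPlane, HasDerivAt Ψ (Ψ' x) x)
    (hpos : ∀ x ∈ rightHalfPlane, 0 < (Ψ' x).re) : InjOn Ψ rightHalfPlane := by
  intro x hx y hy hxy
  by_contra hne
  have h := re_slope_mul_pos (c := 1) hΨ hx hy hne fun t ht => by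
    rw [mul_one]
    exact hpos _ (add_mul_sub_mem_rightHalfPlane hx hy (Ioo_subset_Icc_self ht))
  simp [hxy] at h

/-- By the Cauchy-Riemann equations, the derivative of `Im Ψ` along a vertical line is `Re Ψ'`.
Hence each level curve of `Im Ψ` is a graph over the real axis. -/
theorem strictMono_im_of_re_deriv_pos {Ψ Ψ' : ℂ → ℂ}
    (hΨ : ∀ x ∈ rightHalfPlane, HasDerivAt Ψ (Ψ' x) x)
    (hpos : ∀ x ∈ rightHalfPlane, 0 < (Ψ' x).re) {u : ℝ} (hu : 0 < u) :
    StrictMono fun v : ℝ => (Ψ (u + v * I)).im := by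
  have hmem : ∀ v : ℝ, (u + v * I : ℂ) ∈ rightHalfPlane := fun v => by
    simpa [mem_rightHalfPlane] using hu
  have hder : ∀ v : ℝ, HasDerivAt (fun v : ℝ => (Ψ (u + v * I)).im) (Ψ' (u + v * I)).re v := by
    intro v
    have h1 : HasDerivAt (fun v : ℝ => (u : ℂ) + v * I) (1 * I) v :=
      ((ofRealCLM.hasDerivAt (x := v)).mul_const _).const_add _
    have h2 := HasDerivAt.comp v (hΨ _ (hmem v)) h1
    have h3 := imCLM.hasFDerivAt.comp_hasDerivAt v h2
    convert! h3 using 1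
    simp
  refine strictMono_of_deriv_pos fun v => ?_
  rw [(hder v).deriv]
  exact hpos _ (hmem v)

/-- Horizontal sections of the image of the half-plane under a function whose derivative has
positive real part are connected as soon as the level curves project onto intervals. -/
theorem isPreconnected_section {Ψ Ψ' : ℂ → ℂ} (hΨ : ∀ x ∈ rightHalfPlane, HasDerivAt Ψ (Ψ' x) x)
    (hpos : ∀ x ∈ rightHalfPlane, 0 < (Ψ' x).re) (t : ℝ)
    (hlevel : ∀ u₁ u u₂ v₁ v₂ : ℝ, 0 < u₁ → u₁ ≤ u → u ≤ u₂ → (Ψ (u₁ + v₁ * I)).im = t →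
      (Ψ (u₂ + v₂ * I)).im = t → ∃ v : ℝ, (Ψ (u + v * I)).im = t) :
    IsPreconnected (Ψ '' rightHalfPlane ∩ {w : ℂ | w.im = t}) := by
  have hmem : ∀ u v : ℝ, 0 < u → (u + v * I : ℂ) ∈ rightHalfPlane := fun u v hu => by
    simpa [mem_rightHalfPlane] using hu
  have hmono : ∀ u : ℝ, 0 < u → StrictMono fun v : ℝ => (Ψ (u + v * I)).im := fun u hu =>
    strictMono_im_of_re_deriv_pos hΨ hpos hu
  -- `E` is the projection of the level curve to the real axis; the curve is the graph of a function
  -- `v` on `E`.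
  let E : Set ℝ := {u | 0 < u ∧ ∃ v : ℝ, (Ψ (u + v * I)).im = t}
  have hE : OrdConnected E := by
    refine ⟨fun u₁ h₁ u₂ h₂ u hu => ?_⟩
    obtain ⟨p₁, v₁, hv₁⟩ := h₁
    obtain ⟨-, v₂, hv₂⟩ := h₂
    exact ⟨p₁.trans_le hu.1, hlevel u₁ u u₂ v₁ v₂ p₁ hu.1 hu.2 hv₁ hv₂⟩
  have hex : ∀ u, ∃ v : ℝ, u ∈ E → (Ψ (u + v * I)).im = t := by
    intro u
    by_cases hu : u ∈ E
    · obtain ⟨v, hv⟩ := hu.2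
      exact ⟨v, fun _ => hv⟩
    · exact ⟨0, fun h => absurd h hu⟩
  choose v hv using hex
  have hcontu : ∀ u₀ b : ℝ, 0 < u₀ → ContinuousAt (fun u : ℝ => (Ψ (u + b * I)).im) u₀ := by
    intro u₀ b h₀
    have h1 : ContinuousAt Ψ (u₀ + b * I) := (hΨ _ (hmem u₀ b h₀)).continuousAt
    have h2 : ContinuousAt (fun u : ℝ => (u + b * I : ℂ)) u₀ := by fun_prop
    exact continuous_im.continuousAt.comp
      (ContinuousAt.comp (f := fun u : ℝ => (u + b * I : ℂ)) h1 h2)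
  -- No implicit function theorem is needed: for fixed `b`, the inequality between `Im Ψ (u + b i)`
  -- and `t` persists for nearby `u`, and monotonicity in `v` turns it into a bound on `v u`.
  have hvcont : ContinuousOn v E := by
    intro u₀ h₀
    refine tendsto_order.2 ⟨fun b hb => ?_, fun b hb => ?_⟩
    · have hlt : (Ψ (u₀ + b * I)).im < t := by
        have := hmono u₀ h₀.1 hb
        rwa [← hv u₀ h₀]
      filter_upwards [(hcontu u₀ b h₀.1).continuousWithinAt.eventually (gt_mem_nhds hlt),
        self_mem_nhdsWithin] with u hu huE
      rw [← hv u huE] at hu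
      exact (hmono u huE.1).lt_iff_lt.1 hu
    · have hlt : t < (Ψ (u₀ + b * I)).im := by
        have := hmono u₀ h₀.1 hb
        rwa [← hv u₀ h₀]
      filter_upwards [(hcontu u₀ b h₀.1).continuousWithinAt.eventually (lt_mem_nhds hlt),
        self_mem_nhdsWithin] with u hu huE
      rw [← hv u huE] at hu
      exact (hmono u huE.1).lt_iff_lt.1 hu
  have himage : Ψ '' rightHalfPlane ∩ {w : ℂ | w.im = t} =
      (fun u : ℝ => Ψ (u + v u * I)) '' E := by
    ext w
    constructor
    · rintro ⟨⟨x, hx, rfl⟩, hxt⟩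
      have hxt' : (Ψ (x.re + x.im * I)).im = t := by rwa [re_add_im]
      have hxE : x.re ∈ E := ⟨hx, x.im, hxt'⟩
      refine ⟨x.re, hxE, ?_⟩
      have : v x.re = x.im := (hmono x.re hx).injective ((hv _ hxE).trans hxt'.symm)
      simp only [this, re_add_im]
    · rintro ⟨u, hu, rfl⟩
      exact ⟨mem_image_of_mem _ (hmem u _ hu.1), hv u hu⟩
  rw [himage]
  refine hE.isPreconnected.image _ ?_
  have h1 : ContinuousOn Ψ rightHalfPlane := fun x hx => (hΨ x hx).continuousAt.continuousWithinAt
  refine h1.comp ?_ fun u hu => hmem u _ hu.1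
  exact continuous_ofReal.continuousOn.add
    ((continuous_ofReal.comp_continuousOn hvcont).mul continuousOn_const)

/-! ### Horizontal sections for explicit logarithmic primitives. -/

theorem arg_eq_arctan {x : ℂ} (hx : x ∈ rightHalfPlane) : x.arg = Real.arctan (x.im / x.re) := by
  have h := abs_lt.1 (abs_arg_lt_pi_div_two_iff.2 (Or.inl hx))
  rw [← tan_arg, Real.arctan_tan h.1 h.2]

theorem log_im_eq_arctan {u : ℝ} (hu : 0 < u) (v : ℝ) :
    (log (u + v * I)).im = Real.arctan (v / u) := by
  rw [log_im, arg_eq_arctan (by simpa [mem_rightHalfPlane] using hu)]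
  simp

/-- The range of a positive combination of two arctangents. -/
theorem exists_arctan_add_arctan_eq_iff {A B u : ℝ} (hA : 0 < A) (hB : 0 < B) (hu : 0 < u)
    (τ y : ℝ) :
    (∃ v : ℝ, A * Real.arctan ((v - τ) / u) + B * Real.arctan (v / u) = y) ↔
      |y| < (A + B) * (Real.pi / 2) := by
  constructor
  · rintro ⟨v, rfl⟩
    have h1 := Real.arctan_lt_pi_div_two ((v - τ) / u)
    have h2 := Real.neg_pi_div_two_lt_arctan ((v - τ) / u)
    have h3 := Real.arctan_lt_pi_div_two (v / u)
    have h4 := Real.neg_pi_div_two_lt_arctan (v / u)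
    rw [abs_lt]
    constructor <;> nlinarith
  · intro hy
    rw [abs_lt] at hy
    set F : ℝ → ℝ := fun v => A * Real.arctan ((v - τ) / u) + B * Real.arctan (v / u) with hF
    have hcont : Continuous F := by
      have := Real.continuous_arctan
      fun_prop
    have top : Filter.Tendsto F Filter.atTop (𝓝 (A * (Real.pi / 2) + B * (Real.pi / 2))) := by
      have h0 := Real.tendsto_arctan_atTop.mono_right nhdsWithin_le_nhds
      have h1 : Filter.Tendsto (fun v : ℝ => (v - τ) / u) Filter.atTop Filter.atTop :=
        (Filter.tendsto_atTop_add_const_right _ (-τ) Filter.tendsto_id).atTop_div_const hu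
      have h2 : Filter.Tendsto (fun v : ℝ => v / u) Filter.atTop Filter.atTop :=
        Filter.tendsto_id.atTop_div_const hu
      exact ((h0.comp h1).const_mul A).add ((h0.comp h2).const_mul B)
    have bot : Filter.Tendsto F Filter.atBot (𝓝 (A * -(Real.pi / 2) + B * -(Real.pi / 2))) := by
      have h0 := Real.tendsto_arctan_atBot.mono_right nhdsWithin_le_nhds
      have h1 : Filter.Tendsto (fun v : ℝ => (v - τ) / u) Filter.atBot Filter.atBot :=
        (Filter.tendsto_atBot_add_const_right _ (-τ) Filter.tendsto_id).atBot_div_const hu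
      have h2 : Filter.Tendsto (fun v : ℝ => v / u) Filter.atBot Filter.atBot :=
        Filter.tendsto_id.atBot_div_const hu
      exact ((h0.comp h1).const_mul A).add ((h0.comp h2).const_mul B)
    obtain ⟨v₁, hv₁⟩ := (top.eventually (lt_mem_nhds (show y < _ by linarith [hy.2]))).exists
    obtain ⟨v₂, hv₂⟩ := (bot.eventually (gt_mem_nhds (show _ < y by linarith [hy.1]))).exists
    exact mem_range_of_exists_le_of_exists_ge hcont ⟨v₂, hv₂.le⟩ ⟨v₁, hv₁.le⟩

/-- The linear function dominates the arctangent at infinity. -/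
theorem exists_mul_add_arctan_eq {A B : ℝ} (hA : 0 < A) (hB : 0 < B) (u y : ℝ) :
    ∃ v : ℝ, A * v + B * Real.arctan (v / u) = y := by
  set F : ℝ → ℝ := fun v => A * v + B * Real.arctan (v / u) with hF
  have hcont : Continuous F := by
    have := Real.continuous_arctan
    fun_prop
  refine mem_range_of_exists_le_of_exists_ge hcont
    ⟨(y - B * (Real.pi / 2)) / A, ?_⟩ ⟨(y + B * (Real.pi / 2)) / A, ?_⟩
  · change A * ((y - B * (Real.pi / 2)) / A) + _ ≤ y
    rw [mul_div_cancel₀ _ hA.ne']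
    nlinarith [Real.arctan_lt_pi_div_two ((y - B * (Real.pi / 2)) / A / u)]
  · change y ≤ A * ((y + B * (Real.pi / 2)) / A) + _
    rw [mul_div_cancel₀ _ hA.ne']
    nlinarith [Real.neg_pi_div_two_lt_arctan ((y + B * (Real.pi / 2)) / A / u)]

theorem exists_eq_add_const {Ψ Λ Ψ' : ℂ → ℂ} (hΨ : ∀ x ∈ rightHalfPlane, HasDerivAt Ψ (Ψ' x) x)
    (hΛ : ∀ x ∈ rightHalfPlane, HasDerivAt Λ (Ψ' x) x) :
    ∃ k : ℂ, ∀ x ∈ rightHalfPlane, Ψ x = Λ x + k := by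
  have h1 : (1 : ℂ) ∈ rightHalfPlane := by simp [mem_rightHalfPlane]
  refine ⟨Ψ 1 - Λ 1, isOpen_rightHalfPlane.eqOn_of_deriv_eq convex_rightHalfPlane.isPreconnected
    (fun x hx => (hΨ x hx).differentiableAt.differentiableWithinAt)
    (fun x hx => ((hΛ x hx).add_const _).differentiableAt.differentiableWithinAt)
    (fun x hx => ?_) h1 (by ring)⟩
  rw [(hΨ x hx).deriv, ((hΛ x hx).add_const _).deriv]

/-- The case `e = -1`. On `Re x = u`, `Im Ψ` is `A u v + B arctan(v/u)` plus a constant and takes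
every real value, so every level curve projects onto all of `(0, ∞)`. -/
theorem isPreconnected_section_of_deriv_eq_linear {Ψ : ℂ → ℂ} {A B : ℝ} (hA : 0 < A) (hB : 0 < B)
    (hΨ : ∀ x ∈ rightHalfPlane, HasDerivAt Ψ (A * x + B / x) x)
    (hpos : ∀ x ∈ rightHalfPlane, 0 < (A * x + B / x).re) (t : ℝ) :
    IsPreconnected (Ψ '' rightHalfPlane ∩ {w : ℂ | w.im = t}) := by
  obtain ⟨k, hk⟩ := exists_eq_add_const (Λ := fun x => A * (x ^ 2 / 2) + B * log x) hΨ
    fun x hx => by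
      have h1 := (((hasDerivAt_pow 2 x).div_const 2).const_mul (A : ℂ)).add
        ((hasDerivAt_log (Or.inl hx)).const_mul (B : ℂ))
      convert! h1 using 1
      push_cast
      ring
  refine isPreconnected_section hΨ hpos t fun u₁ u u₂ v₁ v₂ h₁ hu _ _ _ => ?_
  have hu0 := h₁.trans_le hu
  obtain ⟨v, hv⟩ := exists_mul_add_arctan_eq (mul_pos hA hu0) hB u (t - k.im)
  refine ⟨v, ?_⟩
  rw [hk _ (by simpa [mem_rightHalfPlane] using hu0)]
  have e : ((A : ℂ) * ((u + v * I) ^ 2 / 2)).im = A * u * v := by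
    have : (A : ℂ) * ((u + v * I) ^ 2 / 2) =
        ((A * (u ^ 2 - v ^ 2) / 2 : ℝ) : ℂ) + ((A * u * v : ℝ) : ℂ) * I := by
      push_cast
      linear_combination (A * v ^ 2 / 2 : ℂ) * I_sq
    rw [this]
    simp only [add_im, ofReal_im, im_ofReal_mul, I_im, mul_one, zero_add]
  rw [add_im, add_im, e, im_ofReal_mul, log_im_eq_arctan hu0]
  linarith

/-- The case `e ≠ -1`. On `Re x = u`, `Im Ψ` sweeps an open interval of fixed length `(A+B)π` whose
centre is affine in `u`. The `u` for which it contains `t` thus form an interval. -/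
theorem isPreconnected_section_of_deriv_eq_inv {Ψ : ℂ → ℂ} {A B α τ : ℝ} (hA : 0 < A) (hB : 0 < B)
    (hΨ : ∀ x ∈ rightHalfPlane, HasDerivAt Ψ (α * I + A / (x - τ * I) + B / x) x)
    (hpos : ∀ x ∈ rightHalfPlane, 0 < (α * I + A / (x - τ * I) + B / x).re) (t : ℝ) :
    IsPreconnected (Ψ '' rightHalfPlane ∩ {w : ℂ | w.im = t}) := by
  obtain ⟨k, hk⟩ := exists_eq_add_const
    (Λ := fun x => α * I * x + A * log (x - τ * I) + B * log x) hΨ fun x hx => by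
      have h0 := (hasDerivAt_id x).sub_const (τ * I)
      have h1 : HasDerivAt (fun x : ℂ => log (x - τ * I)) (1 / (x - τ * I)) x :=
        h0.clog (Or.inl (by simpa using mem_rightHalfPlane.1 hx))
      have h2 := (((hasDerivAt_id x).const_mul (α * I)).add (h1.const_mul (A : ℂ))).add
        ((hasDerivAt_log (Or.inl hx)).const_mul (B : ℂ))
      convert! h2 using 1
      ring
  have him : ∀ u v : ℝ, 0 < u → (Ψ (u + v * I)).im =
      α * u + (A * Real.arctan ((v - τ) / u) + B * Real.arctan (v / u)) + k.im := by
    intro u v hu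
    rw [hk _ (by simpa [mem_rightHalfPlane] using hu)]
    have e : (u + v * I - τ * I : ℂ) = u + ((v - τ : ℝ) : ℂ) * I := by push_cast; ring
    rw [add_im, add_im, add_im, e, im_ofReal_mul, im_ofReal_mul, log_im_eq_arctan hu,
      log_im_eq_arctan hu]
    simp
    ring
  have hiff : ∀ u : ℝ, 0 < u → ((∃ v : ℝ, (Ψ (u + v * I)).im = t) ↔
      |t - k.im - α * u| < (A + B) * (Real.pi / 2)) := by
    intro u hu
    rw [← exists_arctan_add_arctan_eq_iff hA hB hu τ]
    refine exists_congr fun v => ?_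
    rw [him u v hu]
    constructor <;> intro h <;> linarith
  refine isPreconnected_section hΨ hpos t fun u₁ u u₂ v₁ v₂ h₁ hu hu' hv₁ hv₂ => ?_
  have e₁ := abs_lt.1 ((hiff u₁ h₁).1 ⟨v₁, hv₁⟩)
  have e₂ := abs_lt.1 ((hiff u₂ (h₁.trans_le (hu.trans hu'))).1 ⟨v₂, hv₂⟩)
  refine (hiff u (h₁.trans_le hu)).2 (abs_lt.2 ?_)
  rcases le_total 0 α with hα | hα
  · constructor <;> nlinarith [mul_le_mul_of_nonneg_left hu hα, mul_le_mul_of_nonneg_left hu' hα]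
  · constructor <;> nlinarith [mul_le_mul_of_nonpos_left hu hα, mul_le_mul_of_nonpos_left hu' hα]

/-! ### The half-plane rotation and the pointwise positivity. -/

/-- The Möbius automorphism of the right half-plane corresponding to the rotation
`z ↦ -e z` of the disk. -/
noncomputable def halfPlaneRot (e x : ℂ) : ℂ := ((1 - e) * x + (1 + e)) / ((1 + e) * x + (1 - e))

theorem re_sq_add_im_sq_of_norm_eq_one {e : ℂ} (he : ‖e‖ = 1) : e.re * e.re + e.im * e.im = 1 := by
  rw [← normSq_apply, normSq_eq_norm_sq, he, one_pow]

theorem re_num_mul_conj_den {e : ℂ} (he : ‖e‖ = 1) (x : ℂ) :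
    (((1 - e) * x + (1 + e)) * (starRingEnd ℂ) ((1 + e) * x + (1 - e))).re = 4 * x.re := by
  have h := re_sq_add_im_sq_of_norm_eq_one he
  simp only [add_re, mul_re, add_im, mul_im, sub_re, sub_im, one_re, one_im, conj_re, conj_im]
  linear_combination (2 * x.re - x.re * x.re - x.im * x.im - 1) * h

/-- Combined with `re_num_mul_conj_den`, this supplies the hypothesis `hC` of
`re_polarized_identity`: both of its sides equal `4 Re S (1 + |S|^2)`. -/
theorem normSq_num_add_normSq_den {e : ℂ} (he : ‖e‖ = 1) (x : ℂ) :
    normSq ((1 - e) * x + (1 + e)) + normSq ((1 + e) * x + (1 - e)) = 4 * (1 + normSq x) := by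
  have h := re_sq_add_im_sq_of_norm_eq_one he
  simp only [normSq_apply, add_re, mul_re, add_im, mul_im, sub_re, sub_im, one_re, one_im]
  linear_combination (2 * (1 + x.re * x.re + x.im * x.im) - 4 * x.re) * h

theorem halfPlaneRot_den_ne_zero {e x : ℂ} (he : ‖e‖ = 1) (hx : x ∈ rightHalfPlane) :
    (1 + e) * x + (1 - e) ≠ 0 := by
  intro h0
  have h := re_num_mul_conj_den he x
  rw [h0] at h
  rw [mem_rightHalfPlane] at hx
  simp at h
  exact hx.ne' h

theorem re_halfPlaneRot_pos {e x : ℂ} (he : ‖e‖ = 1) (hx : x ∈ rightHalfPlane) :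
    0 < (halfPlaneRot e x).re := by
  have h0 : 0 < normSq ((1 + e) * x + (1 - e)) := normSq_pos.2 (halfPlaneRot_den_ne_zero he hx)
  rw [halfPlaneRot, div_eq_mul_inv, inv_def, ← mul_assoc, mul_comm, re_ofReal_mul,
    re_num_mul_conj_den he]
  rw [mem_rightHalfPlane] at hx
  positivity

/-- The polynomial identity behind `re_mul_conj_pos`. -/
theorem re_polarized_identity (S n d : ℂ) (p q y t : ℝ)
    (hC : S.re * (normSq n + normSq d) = (n * (starRingEnd ℂ) d).re * (1 + normSq S)) :
    ((p * S * (y * n + t * d * S) + q * (y * d + t * n * S)) * (starRingEnd ℂ) (y * n + t * d * S) *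
      ((starRingEnd ℂ) (p * S * n + q * d) * d)).re =
    (n * (starRingEnd ℂ) d).re * (normSq (y * (p * S * n + q * d) + t * p * S ^ 2 * d) +
      t * y * (p * q * normSq S * (normSq n + normSq d) + q ^ 2 * (1 + normSq S) * normSq d) +
      t ^ 2 * normSq S * normSq d * (q ^ 2 + p * q * (1 + normSq S))) := by
  obtain ⟨s₁, s₂⟩ := S
  obtain ⟨n₁, n₂⟩ := n
  obtain ⟨d₁, d₂⟩ := d
  simp only [pow_two, normSq_apply, add_re, mul_re, add_im, mul_im, conj_re, conj_im, ofReal_re,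
    ofReal_im] at *
  linear_combination (t ^ 2 * p * q * (s₁ * s₁ + s₂ * s₂) * (d₁ * d₁ + d₂ * d₂) +
    t * y * q ^ 2 * (d₁ * d₁ + d₂ * d₂)) * hC

theorem inv_mem_rightHalfPlane {x : ℂ} (hx : x ∈ rightHalfPlane) : x⁻¹ ∈ rightHalfPlane := by
  have h0 := normSq_pos.2 (ne_zero_of_mem_rightHalfPlane hx)
  rw [mem_rightHalfPlane] at *
  rw [inv_re]
  positivity

/-- Clearing denominators with `|S|^2 |d_x|^2 |d|^2` turns the left side into a polynomial in `t`
and `1 - t`. The identity writes it as `4 Re S` times a sum of nonnegative terms with a strictly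
positive last one. -/
theorem re_mul_conj_pos {e S : ℂ} (he : ‖e‖ = 1) (hS : S ∈ rightHalfPlane) {p q t : ℝ}
    (hp : 0 < p) (hq : 0 < q) (ht : t ∈ Ioo (0 : ℝ) 1) :
    0 < ((p * S + q * halfPlaneRot e (S⁻¹ + t * (S - S⁻¹))) *
      (starRingEnd ℂ) (p * halfPlaneRot e S * S + q)).re := by
  have hS0 := ne_zero_of_mem_rightHalfPlane hS
  set x := S⁻¹ + t * (S - S⁻¹) with hx
  have hxR : x ∈ rightHalfPlane :=
    add_mul_sub_mem_rightHalfPlane (inv_mem_rightHalfPlane hS) hS (Ioo_subset_Icc_self ht)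
  have hd0 := halfPlaneRot_den_ne_zero he hS
  have hdx0 := halfPlaneRot_den_ne_zero he hxR
  set n := (1 - e) * S + (1 + e) with hn
  set d := (1 + e) * S + (1 - e) with hd
  have hρ : (n * (starRingEnd ℂ) d).re = 4 * S.re := re_num_mul_conj_den he S
  have hnd : normSq n + normSq d = 4 * (1 + normSq S) := normSq_num_add_normSq_den he S
  have hxS : x * S = (1 - t) + t * S * S := by
    rw [hx]
    field_simp
    ring
  -- At `t = 0`, where `x = 1/S`, numerator and denominator are interchanged: `R(1/S) = 1/R(S)`.
  -- Since `x` is affine in `t`, so are both expressions.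
  have hdx : ((1 + e) * x + (1 - e)) * S = (1 - t : ℝ) * n + t * d * S := by
    push_cast
    linear_combination (1 + e) * hxS
  have hnx : ((1 - e) * x + (1 + e)) * S = (1 - t : ℝ) * d + t * n * S := by
    push_cast
    linear_combination (1 - e) * hxS
  have hid := re_polarized_identity S n d p q (1 - t) t (by rw [hρ, hnd]; ring)
  rw [← hdx, ← hnx] at hid
  set dx := (1 + e) * x + (1 - e) with hdx'
  set nx := (1 - e) * x + (1 + e) with hnx'
  have hpos : 0 < normSq S * normSq dx * normSq d :=
    mul_pos (mul_pos (normSq_pos.2 hS0) (normSq_pos.2 hdx0)) (normSq_pos.2 hd0)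
  have hcd : (starRingEnd ℂ) d ≠ 0 := (map_ne_zero _).2 hd0
  have key : (normSq S * normSq dx * normSq d : ℝ) * ((p * S + q * halfPlaneRot e x) *
      (starRingEnd ℂ) (p * halfPlaneRot e S * S + q)) =
      (p * S * (dx * S) + q * (nx * S)) * (starRingEnd ℂ) (dx * S) *
      ((starRingEnd ℂ) (p * S * n + q * d) * d) := by
    have e1 : halfPlaneRot e x = nx / dx := rfl
    have e2 : halfPlaneRot e S = n / d := rfl
    rw [e1, e2]
    push_cast
    rw [← mul_conj, ← mul_conj, ← mul_conj]
    simp only [map_add, map_mul, map_div₀, conj_ofReal]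
    field_simp
  have hre := congrArg re key
  rw [re_ofReal_mul, hid, hρ] at hre
  refine pos_of_mul_pos_right (b := _) (a := normSq S * normSq dx * normSq d) ?_ hpos.le
  rw [hre]
  have h1 := normSq_pos.2 hd0
  have h2 := normSq_pos.2 hS0
  have h3 := normSq_nonneg n
  have h4 : 0 < 1 - t := sub_pos.2 ht.2
  have h5 := ht.1
  rw [mem_rightHalfPlane] at hS
  have h6 := normSq_nonneg (((1 - t : ℝ) : ℂ) * (p * S * n + q * d) + t * p * S ^ 2 * d)
  refine mul_pos (by positivity) (add_pos_of_nonneg_of_pos (add_nonneg h6 ?_) ?_) <;> positivity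

/-! ### The Cayley transform between disk and half-plane. -/

theorem sub_one_div_add_one_mem_disk {x : ℂ} (hx : x ∈ rightHalfPlane) :
    (x - 1) / (x + 1) ∈ disk := by
  rw [mem_rightHalfPlane] at hx
  have h0 : x + 1 ≠ 0 := fun h => by
    have := congrArg re h
    simp at this
    linarith
  have h1 : 0 < ‖x + 1‖ := norm_pos_iff.2 h0
  rw [mem_disk, norm_div, div_lt_one h1]
  refine lt_of_pow_lt_pow_left₀ 2 h1.le ?_
  rw [← normSq_eq_norm_sq, ← normSq_eq_norm_sq, normSq_apply, normSq_apply]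
  simp
  nlinarith

theorem one_add_div_one_sub_mem_rightHalfPlane {z : ℂ} (hz : z ∈ disk) :
    (1 + z) / (1 - z) ∈ rightHalfPlane := by
  have := re_add_div_sub_pos (x := 1) (y := z) (by simpa using mem_disk.1 hz)
  exact this

theorem add_one_ne_zero_of_mem_rightHalfPlane {x : ℂ} (hx : x ∈ rightHalfPlane) : x + 1 ≠ 0 := by
  intro h
  have := congrArg re h
  rw [mem_rightHalfPlane] at hx
  simp at this
  linarith

theorem cayley_right_inv {x : ℂ} (hx : x ∈ rightHalfPlane) :
    (1 + (x - 1) / (x + 1)) / (1 - (x - 1) / (x + 1)) = x := by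
  have h := add_one_ne_zero_of_mem_rightHalfPlane hx
  have h2 : (1 - (x - 1) / (x + 1)) ≠ 0 :=
    one_sub_ne_zero_of_mem_disk (sub_one_div_add_one_mem_disk hx)
  rw [div_eq_iff h2]
  field_simp
  ring

theorem cayley_left_inv {z : ℂ} (hz : z ∈ disk) :
    ((1 + z) / (1 - z) - 1) / ((1 + z) / (1 - z) + 1) = z := by
  have h := one_sub_ne_zero_of_mem_disk hz
  have h1 := add_one_ne_zero_of_mem_rightHalfPlane (one_add_div_one_sub_mem_rightHalfPlane hz)
  rw [div_eq_iff h1]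
  field_simp
  ring

theorem image_comp_cayley (Φ : ℂ → ℂ) :
    (fun x => Φ ((x - 1) / (x + 1))) '' rightHalfPlane = Φ '' disk := by
  ext w
  constructor
  · rintro ⟨x, hx, rfl⟩
    exact ⟨_, sub_one_div_add_one_mem_disk hx, rfl⟩
  · rintro ⟨z, hz, rfl⟩
    refine ⟨_, one_add_div_one_sub_mem_rightHalfPlane hz, ?_⟩
    simp only [cayley_left_inv hz]

theorem injOn_of_comp_cayley {Φ : ℂ → ℂ}
    (h : InjOn (fun x => Φ ((x - 1) / (x + 1))) rightHalfPlane) : InjOn Φ disk := by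
  intro z hz w hw hzw
  have := h (one_add_div_one_sub_mem_rightHalfPlane hz) (one_add_div_one_sub_mem_rightHalfPlane hw)
    (by simpa only [cayley_left_inv hz, cayley_left_inv hw] using hzw)
  rw [← cayley_left_inv hz, this, cayley_left_inv hw]

/-- For `z = (x-1)/(x+1)` one has `1 - z = 2/(x+1)` and `dz/dx = 2/(x+1)^2`, so the weight
`(1-z)^(-2)` cancels up to the factor `1/2`. -/
theorem hasDerivAt_comp_cayley {Φ M : ℂ → ℂ}
    (hΦ : ∀ z ∈ disk, HasDerivAt Φ (M ((1 + z) / (1 - z)) / (1 - z) ^ 2) z)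
    {x : ℂ} (hx : x ∈ rightHalfPlane) :
    HasDerivAt (fun x => Φ ((x - 1) / (x + 1))) (M x / 2) x := by
  have h := add_one_ne_zero_of_mem_rightHalfPlane hx
  have h1 := hΦ _ (sub_one_div_add_one_mem_disk hx)
  rw [cayley_right_inv hx] at h1
  have h2 := ((hasDerivAt_id x).sub_const 1).div ((hasDerivAt_id x).add_const 1) h
  have h3 := HasDerivAt.comp x h1 h2
  convert! h3 using 1
  have e : 1 - (x - 1) / (x + 1) = 2 / (x + 1) := by field_simp; ring
  rw [e]
  simp only [id]
  field_simp
  ring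

theorem halfPlaneRot_cayley (e : ℂ) {z : ℂ} (hz : z ∈ disk) :
    halfPlaneRot e ((1 + z) / (1 - z)) = (1 - e * z) / (1 + e * z) := by
  have h := one_sub_ne_zero_of_mem_disk hz
  rw [halfPlaneRot]
  have e1 : (1 - e) * ((1 + z) / (1 - z)) + (1 + e) = 2 / (1 - z) * (1 - e * z) := by
    field_simp; ring
  have e2 : (1 + e) * ((1 + z) / (1 - z)) + (1 - e) = 2 / (1 - z) * (1 + e * z) := by
    field_simp; ring
  rw [e1, e2, mul_div_mul_left _ _ (div_ne_zero two_ne_zero h)]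

theorem halfPlaneRot_neg_one (x : ℂ) : halfPlaneRot (-1) x = x := by
  rw [halfPlaneRot]
  norm_num

/-- For `|e| = 1` the quotient `(1-e)/(1+e)` is purely imaginary, say `-τ i`. The rotation then has
its pole at `τ i` on the boundary, and division with remainder gives a form that integrates to a
logarithm. -/
theorem exists_halfPlaneRot_eq {e : ℂ} (he : ‖e‖ = 1) (hne : e ≠ -1) :
    ∃ τ : ℝ, ∀ x ∈ rightHalfPlane,
      halfPlaneRot e x = -τ * I + (1 + τ ^ 2 : ℝ) / (x - τ * I) := by
  have h1 : 1 + e ≠ 0 := fun h => hne (eq_neg_of_add_eq_zero_right h)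
  have hre : ((1 - e) / (1 + e)).re = 0 := by
    have := re_sq_add_im_sq_of_norm_eq_one he
    rw [div_re, ← add_div]
    simp only [sub_re, sub_im, add_re, add_im, one_re, one_im]
    rw [show (1 - e.re) * (1 + e.re) + (0 - e.im) * (0 + e.im) = 0 by linarith, zero_div]
  refine ⟨-((1 - e) / (1 + e)).im, fun x hx => ?_⟩
  set τ : ℝ := -((1 - e) / (1 + e)).im with hτ
  have hμ : (1 - e) = -(τ * I) * (1 + e) := by
    rw [← div_eq_iff h1]
    apply Complex.ext <;> simp [hre, hτ]
  have hx0 : x - τ * I ≠ 0 := by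
    intro h0
    have := congrArg re h0
    rw [mem_rightHalfPlane] at hx
    simp at this
    exact hx.ne' this
  rw [halfPlaneRot, hμ, show -(τ * I) * (1 + e) * x + (1 + e) = (1 + e) * (1 - τ * I * x) by ring,
    show (1 + e) * x + -(τ * I) * (1 + e) = (1 + e) * (x - τ * I) by ring,
    mul_div_mul_left _ _ h1]
  rw [div_eq_iff hx0, add_mul, div_mul_cancel₀ _ hx0]
  push_cast
  linear_combination (τ ^ 2 : ℂ) * (-I_sq)

/-! ### The analytic shear and the symmetric difference quotient. -/

/-- A function `Φ` with `(1 - z) ^ 2 Φ' z = p (1 - e z) / (1 + e z) + q (1 - z) / (1 + z)` is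
univalent and convex in the horizontal direction. -/
theorem injOn_and_isPreconnected_section {Φ : ℂ → ℂ} {e : ℂ} {p q : ℝ} (he : ‖e‖ = 1) (hp : 0 < p)
    (hq : 0 < q)
    (hΦ : ∀ z ∈ disk, HasDerivAt Φ ((p * halfPlaneRot e ((1 + z) / (1 - z)) +
      q / ((1 + z) / (1 - z))) / (1 - z) ^ 2) z) :
    InjOn Φ disk ∧ ∀ t : ℝ, IsPreconnected (Φ '' disk ∩ {w : ℂ | w.im = t}) := by
  have hder : ∀ x ∈ rightHalfPlane, HasDerivAt (fun x => Φ ((x - 1) / (x + 1)))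
      ((p * halfPlaneRot e x + q / x) / 2) x := fun x hx =>
    hasDerivAt_comp_cayley (M := fun x => p * halfPlaneRot e x + q / x) hΦ hx
  have hpos : ∀ x ∈ rightHalfPlane, 0 < ((p * halfPlaneRot e x + q / x) / 2).re := by
    intro x hx
    have h1 := re_halfPlaneRot_pos he hx
    have h2 : 0 < (x⁻¹).re := inv_mem_rightHalfPlane hx
    rw [show (p * halfPlaneRot e x + q / x) / 2 =
      ((1 / 2 : ℝ) : ℂ) * (p * halfPlaneRot e x + q * x⁻¹) by push_cast; ring,
      re_ofReal_mul, add_re, re_ofReal_mul, re_ofReal_mul]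
    positivity
  refine ⟨injOn_of_comp_cayley (injOn_of_re_deriv_pos hder hpos), fun t => ?_⟩
  rw [← image_comp_cayley]
  by_cases h : e = -1
  · subst h
    have heq : ∀ x : ℂ, (p * halfPlaneRot (-1) x + q / x) / 2 =
        ((p / 2 : ℝ) : ℂ) * x + ((q / 2 : ℝ) : ℂ) / x := fun x => by
      rw [halfPlaneRot_neg_one]
      push_cast
      ring
    refine isPreconnected_section_of_deriv_eq_linear (half_pos hp) (half_pos hq)
      (fun x hx => ?_) (fun x hx => ?_) t
    · rw [← heq]; exact hder x hx
    · rw [← heq]; exact hpos x hx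
  · obtain ⟨τ, hτ⟩ := exists_halfPlaneRot_eq he h
    have heq : ∀ x ∈ rightHalfPlane, (p * halfPlaneRot e x + q / x) / 2 =
        ((-(p * τ / 2) : ℝ) : ℂ) * I + ((p * (1 + τ ^ 2) / 2 : ℝ) : ℂ) / (x - τ * I) +
          ((q / 2 : ℝ) : ℂ) / x := fun x hx => by
      rw [hτ x hx]
      push_cast
      ring
    refine isPreconnected_section_of_deriv_eq_inv (α := -(p * τ / 2)) (τ := τ)
      (A := p * (1 + τ ^ 2) / 2) (by positivity) (half_pos hq) (fun x hx => ?_) (fun x hx => ?_) t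
    · rw [← heq x hx]; exact hder x hx
    · rw [← heq x hx]; exact hpos x hx

/-- If `(1 - z) ^ 2 D' z = (1 - e z) / (1 + e z)`, the symmetric difference quotient of `D` lies in
the half-plane determined by `re_mul_conj_pos`. -/
theorem re_symm_quotient_pos {D : ℂ → ℂ} {e : ℂ} {p q : ℝ} (he : ‖e‖ = 1) (hp : 0 < p)
    (hq : 0 < q)
    (hD : ∀ z ∈ disk, HasDerivAt D (halfPlaneRot e ((1 + z) / (1 - z)) / (1 - z) ^ 2) z)
    {z : ℂ} (hz : z ∈ disk) (hz0 : z ≠ 0) :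
    0 < ((p * ((1 + z) / (1 - z)) + q * ((1 - z ^ 2) * (D z - D (-z)) / (2 * z))) *
      (starRingEnd ℂ) (p * halfPlaneRot e ((1 + z) / (1 - z)) * ((1 + z) / (1 - z)) + q)).re := by
  have h1 := one_sub_ne_zero_of_mem_disk hz
  have h2 := one_add_ne_zero_of_mem_disk hz
  set S := (1 + z) / (1 - z) with hS
  set c := (starRingEnd ℂ) (p * halfPlaneRot e S * S + q) with hc
  have hSR : S ∈ rightHalfPlane := one_add_div_one_sub_mem_rightHalfPlane hz
  have hSi : S⁻¹ = (1 + -z) / (1 - -z) := by rw [hS, inv_div]; ring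
  have hdiff : S - S⁻¹ = 4 * z / (1 - z ^ 2) := by
    rw [hS, inv_div, show 1 - z ^ 2 = (1 - z) * (1 + z) by ring]
    field_simp
    ring
  have h3 : 1 - z ^ 2 ≠ 0 := by
    rw [show 1 - z ^ 2 = (1 - z) * (1 + z) by ring]; exact mul_ne_zero h1 h2
  have hne : S - S⁻¹ ≠ 0 := by
    rw [hdiff]
    exact div_ne_zero (mul_ne_zero (by norm_num) hz0) h3
  -- The linear term `p S x` puts the constant `p S` into the difference quotient. The factor 2
  -- offsets the `1/2` from the Cayley transform, so the slope over `[1/S, S]` is `p S` plus `q`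
  -- times the mean of `R`.
  have hder : ∀ x ∈ rightHalfPlane,
      HasDerivAt (fun x => p * S * x + 2 * q * D ((x - 1) / (x + 1)))
        (p * S + q * halfPlaneRot e x) x := by
    intro x hx
    have := ((hasDerivAt_id x).const_mul (p * S)).add
      ((hasDerivAt_comp_cayley hD hx).const_mul (2 * q : ℂ))
    convert! this using 1
    ring
  have h := re_slope_mul_pos (c := c) hder (inv_mem_rightHalfPlane hSR) hSR
    (fun h => hne (sub_eq_zero.2 h.symm)) fun t ht => re_mul_conj_pos he hSR hp hq ht
  have e1 : (S - 1) / (S + 1) = z := cayley_left_inv hz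
  have e2 : (S⁻¹ - 1) / (S⁻¹ + 1) = -z := by rw [hSi]; exact cayley_left_inv (neg_mem_disk hz)
  convert! h using 3
  rw [e1, e2, eq_div_iff hne, add_mul]
  have : q * ((1 - z ^ 2) * (D z - D (-z)) / (2 * z)) * (S - S⁻¹) = 2 * q * (D z - D (-z)) := by
    rw [hdiff]
    field_simp
    ring
  rw [this]
  ring

/-- The real part in the hypothesis equals `|x|^2 - |y|^2`. -/
theorem norm_lt_norm_of_re_mul_conj_pos {x y : ℂ}
    (h : 0 < ((x + y) * (starRingEnd ℂ) (x - y)).re) : ‖y‖ < ‖x‖ := by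
  refine lt_of_pow_lt_pow_left₀ 2 (norm_nonneg _) ?_
  rw [← normSq_eq_norm_sq, ← normSq_eq_norm_sq, normSq_apply, normSq_apply]
  simp only [mul_re, add_re, add_im, conj_re, conj_im, sub_re, sub_im] at h
  nlinarith

/-! ### Explicit form of the half-plane mappings. -/

/-- An analytic function on the disk with `F 0 = 0`, `F' 0 = 1` and `Re F > -1/2` is
`z / (1 - z)`. -/
theorem eq_div_one_sub_of_re_gt {F : ℂ → ℂ} (hF : DifferentiableOn ℂ F disk) (h0 : F 0 = 0)
    (h1 : deriv F 0 = 1) (hre : ∀ z ∈ disk, -(1 / 2) < (F z).re) {z : ℂ} (hz : z ∈ disk) :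
    F z = z / (1 - z) := by
  have hne : ∀ w ∈ disk, 1 + F w ≠ 0 := by
    intro w hw h
    have h2 := congrArg re h
    have h3 := hre w hw
    simp at h2
    linarith
  -- The Möbius map `w/(1+w)` takes `Re w > -1/2` onto the unit disk, so `B` is a Schwarz function
  -- with `B'(0) = 1`; the equality case gives `B z = z`.
  let B : ℂ → ℂ := fun w => F w / (1 + F w)
  have hB : DifferentiableOn ℂ B disk := hF.div (hF.const_add 1) hne
  have hB0 : B 0 = 0 := by simp [B, h0]
  have hmaps : MapsTo B (Metric.ball 0 1) (Metric.ball (B 0) 1) := by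
    intro w hw
    have hw' : w ∈ disk := hw
    rw [hB0, mem_ball_zero_iff, norm_div, div_lt_one (norm_pos_iff.2 (hne w hw'))]
    refine lt_of_pow_lt_pow_left₀ 2 (norm_nonneg _) ?_
    rw [← normSq_eq_norm_sq, ← normSq_eq_norm_sq, normSq_apply, normSq_apply]
    simp
    nlinarith [hre w hw']
  have hFd : HasDerivAt F 1 0 := by
    rw [← h1]
    exact (hF.differentiableAt (isOpen_disk.mem_nhds zero_mem_disk)).hasDerivAt
  have hBd : deriv B 0 = 1 := by
    have := hFd.div (hFd.const_add 1) (hne 0 zero_mem_disk)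
    rw [show B = F / fun w => 1 + F w from rfl, this.deriv, h0]
    norm_num
  have haff := affine_of_mapsTo_ball_of_norm_dslope_eq_div (z₀ := 0) hB
    (hmaps.mono_right Metric.ball_subset_closedBall) (by simp)
    (by rw [dslope_same, hBd]; simp) hz
  have hBz : B z = z := by
    rw [haff, hB0, dslope_same, hBd]
    simp
  have h2 := hne z hz
  have h3 : F z = z * (1 + F z) := (div_eq_iff h2).1 hBz
  rw [eq_div_iff (one_sub_ne_zero_of_mem_disk hz)]
  linear_combination h3

theorem hasDerivAt_mul_div_one_sub (c : ℂ) {z : ℂ} (hz : z ∈ disk) :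
    HasDerivAt (fun z => c * z / (1 - z)) (c / (1 - z) ^ 2) z := by
  have h1 := one_sub_ne_zero_of_mem_disk hz
  have h := ((hasDerivAt_id z).const_mul c).div ((hasDerivAt_id z).const_sub 1) h1
  convert! h using 1
  simp only [id]
  ring

/-- The derivatives of `h` and `g` satisfy `h' + g' = c / (1 - z) ^ 2` if
`h + g = c z / (1 - z)`. -/
theorem deriv_add_deriv_eq {h g : ℂ → ℂ} {c : ℂ} (hh : DifferentiableOn ℂ h disk)
    (hg : DifferentiableOn ℂ g disk) (hsum : ∀ z ∈ disk, h z + g z = c * z / (1 - z)) {z : ℂ}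
    (hz : z ∈ disk) : deriv h z + deriv g z = c / (1 - z) ^ 2 := by
  have hnhds := isOpen_disk.mem_nhds hz
  have h1 := (hh.differentiableAt hnhds).hasDerivAt.add (hg.differentiableAt hnhds).hasDerivAt
  refine h1.unique ((hasDerivAt_mul_div_one_sub c hz).congr_of_eventuallyEq ?_)
  filter_upwards [hnhds] with w hw
  exact hsum w hw

/-- The sum `h' + g'` and the ratio `g'/h'` give `h' = (1+az)/((1-z)^2 (1+z))`. Partial fractions
follow from `1 + az = p(1+z) + q(1-z)` and `z + a = p(1+z) - q(1-z)`, with `p = (1+a)/2` and `q =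
(1-a)/2`. -/
theorem mul_deriv_eq_of_dilatation {h g : ℂ → ℂ} {a : ℝ} (ha : -1 < a) (ha' : a < 1)
    (hh : DifferentiableOn ℂ h disk) (hg : DifferentiableOn ℂ g disk)
    (hsum : ∀ z ∈ disk, h z + g z = (1 + (a : ℂ)) * z / (1 - z))
    (hdil : HasDilatation h g (fun z => (z + (a : ℂ)) / (1 + (a : ℂ) * z)))
    {z : ℂ} (hz : z ∈ disk) :
    z * deriv h z = (1 + a) / 2 * (z / (1 - z) ^ 2) + (1 - a) / 2 * (z / (1 - z ^ 2)) ∧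
    z * deriv g z = (1 + a) / 2 * (z / (1 - z) ^ 2) + -((1 - a) / 2) * (z / (1 - z ^ 2)) := by
  have e1 := one_sub_ne_zero_of_mem_disk hz
  have e2 := one_add_ne_zero_of_mem_disk hz
  have haz : 1 + (a : ℂ) * z ≠ 0 := by
    refine one_add_ne_zero_of_mem_disk (mem_disk.2 ?_)
    rw [norm_mul, norm_real]
    have : ‖a‖ < 1 := abs_lt.2 ⟨ha, ha'⟩
    nlinarith [norm_nonneg z, norm_nonneg a, mem_disk.1 hz]
  have hza : 1 + z * (a : ℂ) ≠ 0 := by rwa [mul_comm]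
  have ha1 : 1 + (a : ℂ) ≠ 0 := by
    exact_mod_cast (by linarith : (1 + a : ℝ) ≠ 0)
  have hadd := deriv_add_deriv_eq hh hg hsum hz
  obtain ⟨hne, hω⟩ := hdil z hz
  have hg' : deriv g z = (z + a) / (1 + a * z) * deriv h z := (div_eq_iff hne).1 hω
  have hh' : deriv h z = (1 + a * z) / ((1 - z) ^ 2 * (1 + z)) := by
    rw [hg'] at hadd
    rw [eq_div_iff (mul_ne_zero (pow_ne_zero 2 e1) e2)]
    rw [eq_div_iff (pow_ne_zero 2 e1)] at hadd
    field_simp at hadd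
    refine mul_left_cancel₀ ha1 ?_
    linear_combination hadd
  rw [hg', hh', show 1 - z ^ 2 = (1 - z) * (1 + z) by ring]
  constructor <;> field_simp <;> ring

/-! ### Assembly of the theorem. -/

theorem locallyUnivalent_of_injOn {f : ℂ → ℂ} (hf : InjOn f disk) : IsLocallyUnivalent f :=
  fun _ hz => ⟨disk, isOpen_disk.mem_nhds hz, hf⟩

/-- The core of the theorem: a pair `H, G` whose derivatives are given by the convolution formulas
is sense-preserving and convex in the horizontal direction. -/
theorem norm_deriv_lt_and_isConvexHorizontal {h₁ g₁ H G : ℂ → ℂ} {e : ℂ} {p q : ℝ} (he : ‖e‖ = 1)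
    (hp : 0 < p) (hq : 0 < q) (hpq : p + q = 1)
    (hh₁ : DifferentiableOn ℂ h₁ disk) (hg₁ : DifferentiableOn ℂ g₁ disk)
    (hH : DifferentiableOn ℂ H disk) (hG : DifferentiableOn ℂ G disk)
    (hsum : ∀ z ∈ disk, h₁ z + g₁ z = z / (1 - z))
    (hdil : HasDilatation h₁ g₁ fun z => e * z)
    (hH' : ∀ z ∈ disk, z * deriv H z = p * (z * deriv h₁ z) + q / 2 * (h₁ z - h₁ (-z)))
    (hG' : ∀ z ∈ disk, z * deriv G z = p * (z * deriv g₁ z) + -q / 2 * (g₁ z - g₁ (-z)))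
    (hH0 : deriv H 0 = 1) (hG0 : deriv G 0 = 0) :
    (∀ z ∈ disk, ‖deriv G z‖ < ‖deriv H z‖) ∧ IsConvexHorizontal (harm H G) := by
  have hez : ∀ z ∈ disk, 1 + e * z ≠ 0 := fun z hz =>
    one_add_ne_zero_of_mem_disk (mem_disk.2 (by rw [norm_mul, he, one_mul]; exact mem_disk.1 hz))
  have hadd : ∀ z ∈ disk, deriv h₁ z + deriv g₁ z = 1 / (1 - z) ^ 2 := fun z hz =>
    deriv_add_deriv_eq hh₁ hg₁ (fun w hw => by rw [hsum w hw, one_mul]) hz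
  have hsub : ∀ z ∈ disk,
      deriv h₁ z - deriv g₁ z = halfPlaneRot e ((1 + z) / (1 - z)) / (1 - z) ^ 2 := by
    intro z hz
    have h1 : deriv g₁ z = e * z * deriv h₁ z := (div_eq_iff (hdil z hz).1).1 (hdil z hz).2
    have h2 := hadd z hz
    have e1 := one_sub_ne_zero_of_mem_disk hz
    have e2 := hez z hz
    rw [halfPlaneRot_cayley e hz, h1, div_div, eq_div_iff (mul_ne_zero e2 (pow_ne_zero 2 e1))]
    rw [h1, eq_div_iff (pow_ne_zero 2 e1)] at h2
    linear_combination (1 - e * z) * h2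
  let D : ℂ → ℂ := fun z => h₁ z - g₁ z
  have hD : ∀ z ∈ disk, HasDerivAt D (halfPlaneRot e ((1 + z) / (1 - z)) / (1 - z) ^ 2) z := by
    intro z hz
    have hnhds := isOpen_disk.mem_nhds hz
    rw [← hsub z hz]
    exact (hh₁.differentiableAt hnhds).hasDerivAt.sub (hg₁.differentiableAt hnhds).hasDerivAt
  have hHG : ∀ z ∈ disk, deriv H z - deriv G z =
      (p * halfPlaneRot e ((1 + z) / (1 - z)) * ((1 + z) / (1 - z)) + q) / (1 - z ^ 2) := by
    intro z hz
    have e1 := one_sub_ne_zero_of_mem_disk hz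
    have e2 := one_add_ne_zero_of_mem_disk hz
    -- The formulas determine `z H'` and `z G'` only, so the origin is settled by the normalization
    -- and `p + q = 1`.
    rcases eq_or_ne z 0 with rfl | hz0
    · rw [halfPlaneRot_cayley e hz, hH0, hG0]
      simp
      exact_mod_cast hpq.symm
    · refine mul_left_cancel₀ hz0 ?_
      have h1 := hsum z hz
      have h2 := hsum (-z) (neg_mem_disk hz)
      rw [mul_sub, hH' z hz, hG' z hz]
      -- The opposite signs of `q` combine the odd parts into that of `h₁ + g₁`, which is known
      -- explicitly.
      have : p * (z * deriv h₁ z) + q / 2 * (h₁ z - h₁ (-z)) -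
          (p * (z * deriv g₁ z) + -q / 2 * (g₁ z - g₁ (-z))) =
          p * z * (deriv h₁ z - deriv g₁ z) +
            q / 2 * ((h₁ z + g₁ z) - (h₁ (-z) + g₁ (-z))) := by ring
      rw [this, hsub z hz, h1, h2, sub_neg_eq_add, show 1 - z ^ 2 = (1 - z) * (1 + z) by ring]
      field_simp
      ring
  have hlt : ∀ z ∈ disk, ‖deriv G z‖ < ‖deriv H z‖ := by
    intro z hz
    rcases eq_or_ne z 0 with rfl | hz0
    · rw [hH0, hG0]
      simp
    · have e1 := one_sub_ne_zero_of_mem_disk hz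
      have e2 := one_add_ne_zero_of_mem_disk hz
      have e3 : 1 - z ^ 2 ≠ 0 := by
        rw [show 1 - z ^ 2 = (1 - z) * (1 + z) by ring]; exact mul_ne_zero e1 e2
      have hsumHG : deriv H z + deriv G z = (p * ((1 + z) / (1 - z)) +
          q * ((1 - z ^ 2) * (D z - D (-z)) / (2 * z))) / (1 - z ^ 2) := by
        refine mul_left_cancel₀ hz0 ?_
        rw [mul_add, hH' z hz, hG' z hz]
        have : p * (z * deriv h₁ z) + q / 2 * (h₁ z - h₁ (-z)) +
            (p * (z * deriv g₁ z) + -q / 2 * (g₁ z - g₁ (-z))) =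
            p * z * (deriv h₁ z + deriv g₁ z) + q / 2 * (D z - D (-z)) := by
          simp only [D]; ring
        rw [this, hadd z hz, add_div, mul_add]
        congr 1
        · rw [show 1 - z ^ 2 = (1 - z) * (1 + z) by ring]
          field_simp
        · field_simp
      refine norm_lt_norm_of_re_mul_conj_pos ?_
      rw [hsumHG, hHG z hz, map_div₀, div_mul_div_comm, mul_conj, div_ofReal_re]
      exact div_pos (re_symm_quotient_pos he hp hq hD hz hz0) (normSq_pos.2 e3)
  have hΦ := injOn_and_isPreconnected_section (Φ := fun z => H z - G z) he hp hq fun z hz => by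
    have hnhds := isOpen_disk.mem_nhds hz
    have e1 := one_sub_ne_zero_of_mem_disk hz
    have e2 := one_add_ne_zero_of_mem_disk hz
    convert! (hH.differentiableAt hnhds).hasDerivAt.sub (hG.differentiableAt hnhds).hasDerivAt
      using 1
    rw [hHG z hz, show 1 - z ^ 2 = (1 - z) * (1 + z) by ring]
    field_simp
  exact ⟨hlt, isConvexHorizontal_harm hH hG hlt hΦ.1 hΦ.2⟩

end HarmonicConv

open HarmonicConv in
theorem theorem2p1 (a θ : ℝ) (ha : -1 < a) (ha' : a < 1) (h g h₁ g₁ : ℂ → ℂ)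
    (hf : HarmonicConv.IsRightHalfPlane a h g)
    (hsum : ∀ z ∈ HarmonicConv.disk, h z + g z = (1 + (a : ℂ)) * z / (1 - z))
    (hdil : HarmonicConv.HasDilatation h g (fun z => (z + (a : ℂ)) / (1 + (a : ℂ) * z)))
    (hf₁ : HarmonicConv.IsRightHalfPlane 0 h₁ g₁)
    (hdil₁ : HarmonicConv.HasDilatation h₁ g₁ (fun z => Complex.exp ((θ : ℂ) * Complex.I) * z)) :
    let H := HarmonicConv.hadamard h₁ h
    let G := HarmonicConv.hadamard g₁ g
    -- the convolution is again a normalized harmonic mapping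
    HarmonicConv.IsNormalized H G ∧
    -- its dilatation is well defined and of modulus less than one
    (∀ z ∈ HarmonicConv.disk, deriv H z ≠ 0 ∧ ‖deriv G z / deriv H z‖ < 1) ∧
    HarmonicConv.IsLocallyUnivalent (HarmonicConv.harm H G) ∧
    HarmonicConv.IsConvexHorizontal (HarmonicConv.harm H G) := by
  intro H G
  have hn := hf.mem_SH.normalized
  have hn₁ := hf₁.mem_SH.normalized
  have hH : DifferentiableOn ℂ H disk := differentiableOn_hadamard hn₁.analytic_h hn.analytic_h
  have hG : DifferentiableOn ℂ G disk := differentiableOn_hadamard hn₁.analytic_g hn.analytic_g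
  have hg₁0 : deriv g₁ 0 = 0 := by simpa using hf₁.deriv_g_zero
  have hH0 : deriv H 0 = 1 := by
    rw [deriv_hadamard_zero hn₁.analytic_h hn.analytic_h, hn₁.deriv_h_zero, hn.deriv_h_zero, one_mul]
  have hG0 : deriv G 0 = 0 := by
    rw [deriv_hadamard_zero hn₁.analytic_g hn.analytic_g, hg₁0, zero_mul]
  -- For `f₁` the closed form is derived from the half-plane condition: with parameter 0, `h₁ + g₁`
  -- has derivative 1 at the origin and real part above `-1/2`.
  have hsum₁ : ∀ z ∈ disk, h₁ z + g₁ z = z / (1 - z) := by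
    intro z hz
    refine eq_div_one_sub_of_re_gt (F := fun z => h₁ z + g₁ z)
      (hn₁.analytic_h.add hn₁.analytic_g) ?_ ?_ (fun w hw => ?_) hz
    · simp only [hn₁.h_zero, hn₁.g_zero, add_zero]
    · have hnhds := isOpen_disk.mem_nhds zero_mem_disk
      have h1 := (hn₁.analytic_h.differentiableAt hnhds).hasDerivAt.add
        (hn₁.analytic_g.differentiableAt hnhds).hasDerivAt
      rw [hn₁.deriv_h_zero, hg₁0, add_zero] at h1
      exact h1.deriv
    · have := hf₁.re_gt w hw
      rw [harm_re] at this
      linarith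
  have hpos : 0 < (1 + a) / 2 := by linarith
  have hpos' : 0 < (1 - a) / 2 := by linarith
  have hmul := fun z (hz : z ∈ disk) =>
    mul_deriv_eq_of_dilatation ha ha' hn.analytic_h hn.analytic_g hsum hdil hz
  obtain ⟨hlt, hchd⟩ := norm_deriv_lt_and_isConvexHorizontal (p := (1 + a) / 2) (q := (1 - a) / 2)
    (norm_exp_ofReal_mul_I θ) hpos hpos' (by ring) hn₁.analytic_h hn₁.analytic_g hH hG hsum₁ hdil₁
    (fun z hz => by
      push_cast
      exact mul_deriv_hadamard hn₁.analytic_h hn.analytic_h (fun w hw => (hmul w hw).1) hz)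
    (fun z hz => by
      push_cast
      exact mul_deriv_hadamard hn₁.analytic_g hn.analytic_g (fun w hw => (hmul w hw).2) hz)
    hH0 hG0
  refine ⟨⟨hH, hG, ?_, ?_, hH0⟩, fun z hz => ?_, locallyUnivalent_of_injOn hchd.1, hchd⟩
  · rw [show H 0 = h₁ 0 * h 0 from hadamard_zero hn₁.analytic_h hn.analytic_h, hn.h_zero, mul_zero]
  · rw [show G 0 = g₁ 0 * g 0 from hadamard_zero hn₁.analytic_g hn.analytic_g, hn.g_zero, mul_zero]
  · have h0 : 0 < ‖deriv H z‖ := (norm_nonneg _).trans_lt (hlt z hz)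
    exact ⟨norm_pos_iff.1 h0, by rw [norm_div, div_lt_one h0]; exact hlt z hz⟩
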